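/- Let $J\subset\mathbb R$ be an open interval and let $\{\Sigma(t)\}_{t\in J}$ be a $\mathcal C^{1,2}$-family of moving hypersurfaces in $\mathbb R^n$ with graph $\mathcal M=\{(t,x): t\in J,\ x\in\Sigma(t)\}$. That is, each $\Sigma(t)$ is a nonempty orientable embedded $\mathcal C^2$-hypersurface without boundary in $\mathbb R^n$ with continuous unit normal field $n_\Sigma(t,\cdot)$; $\mathcal M$ is an embedded $\mathcal C^1$-hypersurface without boundary in $\mathbb R\times\mathbb R^n$; and $n_\Sigma\in\mathcal C^1(\mathcal M;\mathbb R^n)$. Assume moreover that $\mathcal M$ is nowhere tangent to a time slice, i.e. at every point of $\mathcal M$ there is a tangent vector $(\tau,u)\in\mathbb R\times\mathbb R^n$ of $\mathcal M$ with $\tau\neq 0$. Then the speed of normal displacement $V_\Sigma$ is well defined on $\mathcal M$: for every $(t,x)\in\mathcal M$ there is exactly one real number $V_\Sigma(t,x)$ with $$\lim_{h\to 0+}\frac1h\,\mathrm{dist}\big(x+h\,V_\Sigma(t,x)\,n_\Sigma(t,x),\ \Sigma(t+h)\big)=0 .$$ Moreover, $V_\Sigma\in\mathcal C(\mathcal M)$,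 the surface gradient $\nabla_\Sigma V_\Sigma(t,x)$ (the vector in the tangent space of $\Sigma(t)$ at $x$ that represents the derivative of $V_\Sigma(t,\cdot)$ along $\Sigma(t)$) exists at every $(t,x)\in\mathcal M$, and $\nabla_\Sigma V_\Sigma\in\mathcal C(\mathcal M;\mathbb R^n)$. Furthermore, the intrinsic velocity field $w^\Sigma(t,x):=V_\Sigma(t,x)\,n_\Sigma(t,x)$, $(t,x)\in\mathcal M$, satisfies $w^\Sigma\in\mathcal C(\mathcal M;\mathbb R^n)$; its surface gradient $\nabla_\Sigma w^\Sigma$ (the derivative of $w^\Sigma(t,\cdot)$ along $\Sigma(t)$, extended by zero in the normal direction) exists on $\mathcal M$ with $\nabla_\Sigma w^\Sigma\in\mathcal C(\mathcal M;\mathbb R^{n\times n})$; and $w^\Sigma$ is consistent with $\mathcal M$. The latter means that $w^\Sigma$ is continuous on $\mathcal M$, that $w^\Sigma(t,\cdot)$ is locally Lipschitz continuous on $\Sigma(t)$ for every $t\in J$, and that for every $(t_0,x_0)\in\mathcal M$ the initial value problem $$\dot x(t)=w^\Sigma(t,x(t)),\qquad x(t)\in\Sigma(t),\qquad x(t_0)=x_0,$$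 has, locally in time, forward and backward, a unique absolutely continuous solution: there are $\varepsilon>0$ with $[t_0-\varepsilon,t_0+\varepsilon]\subset J$ and a solution on $[t_0-\varepsilon,t_0+\varepsilon]$, and any two solutions on an interval $I\subset J$ with $t_0\in I$ coincide on $I$. -/

import Mathlib

open Set Filter Topology MeasureTheory

/-- `S` is an embedded `C^k` hypersurface without boundary in the normed space `F`: near each of
its points, `S` is the zero set of a `C^k` function whose derivative does not vanish on `S`. -/
def IsHypersurface {F : Type*} [NormedAddCommGroup F] [NormedSpace ℝ F] (k : ℕ) (S : Set F) :
    Prop :=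
  ∀ p ∈ S, ∃ U : Set F, IsOpen U ∧ p ∈ U ∧ ∃ φ : F → ℝ,
    ContDiffOn ℝ k φ U ∧ S ∩ U = {q ∈ U | φ q = 0} ∧ ∀ q ∈ S ∩ U, fderiv ℝ φ q ≠ 0

/-- `f` is continuously differentiable on the `C^1` hypersurface `M`: near each point of `M` it is
the restriction of a `C^1` function defined on an open set of the ambient space. -/
def IsC1OnHypersurface {F G : Type*} [NormedAddCommGroup F] [NormedSpace ℝ F]
    [NormedAddCommGroup G] [NormedSpace ℝ G] (M : Set F) (f : F → G) : Prop :=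
  ∀ p ∈ M, ∃ U : Set F, IsOpen U ∧ p ∈ U ∧ ∃ g : F → G,
    ContDiffOn ℝ 1 g U ∧ ∀ q ∈ M ∩ U, g q = f q

namespace MovingHypersurface

variable {n : ℕ}

/-- The graph `{(t, x) : t ∈ J, x ∈ S t}` of a family `S` of sets over `J`. -/
def graph (J : Set ℝ) (S : ℝ → Set (EuclideanSpace ℝ (Fin n))) :
    Set (ℝ × EuclideanSpace ℝ (Fin n)) :=
  {p | p.1 ∈ J ∧ p.2 ∈ S p.1}

/-- `ν` is a continuous unit normal field on the hypersurface `S`. On a hypersurface,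
`tangentConeAt ℝ S x` is the tangent space at `x`. -/
def IsUnitNormalField (S : Set (EuclideanSpace ℝ (Fin n)))
    (ν : EuclideanSpace ℝ (Fin n) → EuclideanSpace ℝ (Fin n)) : Prop :=
  ContinuousOn ν S ∧ ∀ x ∈ S, ‖ν x‖ = 1 ∧ ∀ u ∈ tangentConeAt ℝ S x, inner ℝ (ν x) u = 0

/-- `{S t}`, `t ∈ J`, is a `C^{1,2}`-family of moving hypersurfaces with unit normal field `ν`. -/
structure IsC12Family (J : Set ℝ) (S : ℝ → Set (EuclideanSpace ℝ (Fin n)))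
    (ν : ℝ × EuclideanSpace ℝ (Fin n) → EuclideanSpace ℝ (Fin n)) : Prop where
  /-- the slices are nonempty -/
  nonempty_slice : ∀ t ∈ J, (S t).Nonempty
  /-- each slice is a `C^2` hypersurface -/
  hypersurface_slice : ∀ t ∈ J, IsHypersurface 2 (S t)
  /-- each slice is oriented by the unit normal field `ν (t, ·)` -/
  normal_slice : ∀ t ∈ J, IsUnitNormalField (S t) (fun x => ν (t, x))
  /-- the graph is a `C^1` hypersurface in space-time -/
  hypersurface_graph : IsHypersurface 1 (graph J S)
  /-- the normal field is continuously differentiable on the graph -/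
  normal_graph : IsC1OnHypersurface (graph J S) ν

/-- The graph is nowhere tangent to a time slice `{t} × ℝⁿ`: at each of its points it has a tangent
vector `(τ, u)` with `τ ≠ 0`. -/
def IsTransversalToSlices (J : Set ℝ) (S : ℝ → Set (EuclideanSpace ℝ (Fin n))) : Prop :=
  ∀ p ∈ graph J S, ∃ z ∈ tangentConeAt ℝ (graph J S) p, z.1 ≠ 0

/-- `c` is a speed of normal displacement of the family `S` at `p = (t, x)`:
`lim_{h → 0+} h⁻¹ dist (x + h c ν(t, x), S (t + h)) = 0`. -/
def IsNormalSpeedAt (S : ℝ → Set (EuclideanSpace ℝ (Fin n)))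
    (ν : ℝ × EuclideanSpace ℝ (Fin n) → EuclideanSpace ℝ (Fin n))
    (p : ℝ × EuclideanSpace ℝ (Fin n)) (c : ℝ) : Prop :=
  Tendsto (fun h : ℝ => h⁻¹ * Metric.infDist (p.2 + (h * c) • ν p) (S (p.1 + h)))
    (𝓝[>] 0) (𝓝 0)

/-- `G` is the surface gradient on the graph of the scalar field `f`: for `(t, x)` in the graph,
`G (t, x)` is the tangential vector representing the derivative of `f (t, ·)` along `S t`. -/
def IsSurfaceGradient (J : Set ℝ) (S : ℝ → Set (EuclideanSpace ℝ (Fin n)))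
    (ν : ℝ × EuclideanSpace ℝ (Fin n) → EuclideanSpace ℝ (Fin n))
    (f : ℝ × EuclideanSpace ℝ (Fin n) → ℝ)
    (G : ℝ × EuclideanSpace ℝ (Fin n) → EuclideanSpace ℝ (Fin n)) : Prop :=
  ∀ p ∈ graph J S,
    HasGradientWithinAt (fun y => f (p.1, y)) (G p) (S p.1) p.2 ∧ inner ℝ (G p) (ν p) = 0

/-- `A` is the surface gradient on the graph of the vector field `w`: for `(t, x)` in the graph,
the linear map `A (t, x)` is the derivative of `w (t, ·)` along `S t`, extended by zero in the
normal direction. -/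
def IsSurfaceJacobian (J : Set ℝ) (S : ℝ → Set (EuclideanSpace ℝ (Fin n)))
    (ν : ℝ × EuclideanSpace ℝ (Fin n) → EuclideanSpace ℝ (Fin n))
    (w : ℝ × EuclideanSpace ℝ (Fin n) → EuclideanSpace ℝ (Fin n))
    (A : ℝ × EuclideanSpace ℝ (Fin n) →
      EuclideanSpace ℝ (Fin n) →L[ℝ] EuclideanSpace ℝ (Fin n)) : Prop :=
  ∀ p ∈ graph J S,
    HasFDerivWithinAt (fun y => w (p.1, y)) (A p) (S p.1) p.2 ∧ A p (ν p) = 0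

/-- `x` is, on the interval `I ∋ t₀`, a (locally) absolutely continuous solution of
`x' = w (t, x)`, `x t₀ = x₀`, subject to the constraint `x t ∈ S t`. -/
structure IsACSolution (S : ℝ → Set (EuclideanSpace ℝ (Fin n)))
    (w : ℝ × EuclideanSpace ℝ (Fin n) → EuclideanSpace ℝ (Fin n))
    (I : Set ℝ) (t₀ : ℝ) (x₀ : EuclideanSpace ℝ (Fin n))
    (x : ℝ → EuclideanSpace ℝ (Fin n)) : Prop where
  absCont : ∀ c ∈ I, ∀ d ∈ I, AbsolutelyContinuousOnInterval x c d
  mem_slice : ∀ t ∈ I, x t ∈ S t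
  integrable : ∀ t ∈ I, IntervalIntegrable (fun s => w (s, x s)) volume t₀ t
  eq_integral : ∀ t ∈ I, x t = x₀ + ∫ s in t₀..t, w (s, x s)

/-- The velocity field `w` on the graph is consistent with the graph: it is continuous, locally
Lipschitz on each slice, and through each point `(t₀, x₀)` of the graph there is, locally forward
and backward in time, an absolutely continuous solution of the initial value problem; it is unique
on every interval `I ⊆ J` containing `t₀` (in particular also on one-sided intervals). -/
structure IsConsistent (J : Set ℝ) (S : ℝ → Set (EuclideanSpace ℝ (Fin n)))
    (w : ℝ × EuclideanSpace ℝ (Fin n) → EuclideanSpace ℝ (Fin n)) : Prop where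
  continuousOn : ContinuousOn w (graph J S)
  locallyLipschitz : ∀ t ∈ J, LocallyLipschitzOn (S t) (fun x => w (t, x))
  exists_solution : ∀ t₀ ∈ J, ∀ x₀ ∈ S t₀, ∃ ε > 0, Icc (t₀ - ε) (t₀ + ε) ⊆ J ∧
    ∃ x, IsACSolution S w (Icc (t₀ - ε) (t₀ + ε)) t₀ x₀ x
  unique_solution : ∀ t₀ ∈ J, ∀ x₀ ∈ S t₀, ∀ I : Set ℝ, I.OrdConnected → t₀ ∈ I → I ⊆ J →
    ∀ x y, IsACSolution S w I t₀ x₀ x → IsACSolution S w I t₀ x₀ y → EqOn x y I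

end MovingHypersurface

/-!
Near a point of the graph `M ⊆ ℝ × ℝⁿ` the implicit function theorem, applied in a spatial
direction `e` transversal to the slices, yields a defining function `φ` normalised by
`φ (t, x + s e) = φ (t, x) + s` (`exists_isGraphChartAt`). Thus `φ` is a height over the hypersurface in
direction `e`, the map `(t, x) ↦ (t, x - φ (t, x) e)` projects onto `M`, and the derivative of `φ`
does not change along `e`.

The distance from a point near `M` to the slice at the same time is comparable to `|φ|`, so `c` is
a normal speed exactly when `φ` has derivative zero in the direction `(1, c ν)`
(`isNormalSpeedAt_iff`). This gives `V = -∂ₜφ ⟨ν, e⟩`, which is only continuous at first sight. The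
missing spatial regularity comes from the normal: `∂ₓφ` is `⟨ν, ·⟩ / ⟨ν, e⟩` on `M`, hence, being
constant along `e`, it is `C¹` in space-time because `ν` is `C¹` on `M`. Interchanging the order of
differentiation (`isSpatiallyC1At_fderiv_time`) then shows that `∂ₜφ` is differentiable in `x`,
with derivative `∂ₜ∂ₓφ`, which is jointly continuous.

Consequently `V` and `w = V ν` extend near each point of `M` to functions with a jointly continuous
spatial derivative (`exists_velocity_extension`); composing that derivative with the projection
onto the tangent space gives the surface derivatives (`exists_surfaceDerivative`). The extension of
`w` is moreover tangent to all level sets of `φ`, not only to `M`, so the Picard–Lindelöf solutions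
of the extended equation that start on `M` stay on `M` (`exists_isACSolution`). Uniqueness is
Grönwall's inequality for the locally uniformly Lipschitz field `w`, made global on intervals by
connectedness (`eqOn_Icc_of_isLocallyUniformlyLipschitz`).
-/

/-! ### Defining functions normalised along a transversal direction -/

section Charts

variable {E : Type*} [NormedAddCommGroup E] [NormedSpace ℝ E]

/-- Near `p`, the set `M` is the zero set of the `C¹` function `φ`, and `φ` increases with unit
speed along the spatial direction `e`. For `p ∈ M` this says that `M` is near `p` a `C¹` graph in
direction `e`, and that `φ` is the height above it. -/
structure IsGraphChartAt (M : Set (ℝ × E)) (φ : ℝ × E → ℝ) (e : E) (p : ℝ × E) : Prop where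
  contDiffAt : ContDiffAt ℝ 1 φ p
  mem_iff : ∀ᶠ q in 𝓝 p, (q ∈ M ↔ φ q = 0)
  translate : ∀ᶠ z : (ℝ × E) × ℝ in 𝓝 (p, 0), φ (z.1 + (0, z.2 • e)) = φ z.1 + z.2

theorem fderiv_eq_zero_of_mem_tangentConeAt {F : Type*} [NormedAddCommGroup F] [NormedSpace ℝ F]
    {M : Set F} {ψ : F → ℝ} {p z : F} (hψ : DifferentiableAt ℝ ψ p)
    (h0 : ∀ᶠ q in 𝓝[M] p, ψ q = 0) (hp : ψ p = 0) (hz : z ∈ tangentConeAt ℝ M p) :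
    fderiv ℝ ψ p z = 0 := by
  have h1 : HasFDerivWithinAt ψ (fderiv ℝ ψ p) M p := hψ.hasFDerivAt.hasFDerivWithinAt
  have h2 : HasFDerivWithinAt ψ (0 : F →L[ℝ] ℝ) M p :=
    (hasFDerivWithinAt_const (0 : ℝ) p M).congr_of_eventuallyEq h0 hp
  simpa using h1.unique_on h2 hz

/-- A space-time hypersurface with a tangent vector that is not purely spatial at `p` is a graph in
a spatial direction near `p`. -/
theorem exists_isGraphChartAt [CompleteSpace E] {M : Set (ℝ × E)} (hM : IsHypersurface 1 M)
    {p : ℝ × E} (hp : p ∈ M) {z : ℝ × E} (hz : z ∈ tangentConeAt ℝ M p) (hz1 : z.1 ≠ 0) :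
    ∃ φ e, IsGraphChartAt M φ e p := by
  obtain ⟨U, hU, hpU, ψ, hψ, hMU, hne⟩ := hM p hp
  have hUp : U ∈ 𝓝 p := hU.mem_nhds hpU
  have hmem : ∀ q ∈ U, (q ∈ M ↔ ψ q = 0) := fun q hq => by
    have := Set.ext_iff.1 hMU q
    simp only [mem_inter_iff, mem_ofPred_eq, hq, and_true, true_and] at this
    exact this
  have hψp : ContDiffAt ℝ 1 ψ p := by exact_mod_cast hψ.contDiffAt hUp
  have hp0 : ψ p = 0 := (hmem p hpU).1 hp
  have hdz : fderiv ℝ ψ p z = 0 := by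
    refine fderiv_eq_zero_of_mem_tangentConeAt (hψp.differentiableAt (by simp)) ?_ hp0 hz
    filter_upwards [self_mem_nhdsWithin, mem_nhdsWithin_of_mem_nhds hUp] with q h1 h2
    exact (hmem q h2).1 h1
  -- Otherwise the spatial derivative vanishes, and `z.1 ≠ 0` kills the time derivative as well.
  obtain ⟨e, he⟩ : ∃ e : E, fderiv ℝ ψ p (0, e) ≠ 0 := by
    by_contra! hcon
    apply hne p ⟨hp, hpU⟩
    have h1 : fderiv ℝ ψ p (1, 0) = 0 := by
      have : z = z.1 • ((1 : ℝ), (0 : E)) + (0, z.2) := by ext <;> simp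
      rw [this, map_add, hcon, map_smul, add_zero, smul_eq_mul] at hdz
      exact (mul_eq_zero.1 hdz).resolve_left hz1
    ext v
    · simpa using h1
    · simpa using hcon v
  -- The height `φ q` is the solution `s` of `ψ (q - (0, s e)) = 0`.
  let T : (ℝ × E) × ℝ → ℝ × E := fun w => w.1 - (0, w.2 • e)
  let T' : (ℝ × E) × ℝ →L[ℝ] ℝ × E := ContinuousLinearMap.fst ℝ (ℝ × E) ℝ -
    (ContinuousLinearMap.inr ℝ ℝ E).comp ((ContinuousLinearMap.snd ℝ (ℝ × E) ℝ).smulRight e)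
  have hTT : T = T' := by
    ext w <;> simp [T, T']
  have hTp : T (p, 0) = p := by simp [T]
  have hF : ContDiffAt ℝ 1 (fun w => ψ (T w)) (p, (0 : ℝ)) := by
    apply ContDiffAt.comp
    · rwa [hTp]
    · rw [hTT]; exact T'.contDiff.contDiffAt
  have hF' : fderiv ℝ (fun w => ψ (T w)) (p, (0 : ℝ)) = (fderiv ℝ ψ p).comp T' := by
    have h1 : HasFDerivAt T T' (p, (0 : ℝ)) := by rw [hTT]; exact T'.hasFDerivAt
    have h2 : HasFDerivAt ψ (fderiv ℝ ψ p) (T (p, 0)) := by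
      rw [hTp]; exact (hψp.differentiableAt (by simp)).hasFDerivAt
    exact (h2.comp (p, (0 : ℝ)) h1).fderiv
  have hinv : ((fderiv ℝ (fun w => ψ (T w)) (p, (0 : ℝ))).comp
      (ContinuousLinearMap.inr ℝ (ℝ × E) ℝ)).IsInvertible := by
    refine ⟨ContinuousLinearEquiv.unitsEquivAut ℝ (Units.mk0 _ (neg_ne_zero.2 he)), ?_⟩
    ext
    rw [hF']
    simp [T']
  have hone : (1 : WithTop ℕ∞) ≠ 0 := by simp
  have hcd := hF.contDiffAt_implicitFunction hone hinv
  have hiff := hF.eventually_apply_eq_iff_implicitFunction hone hinv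
  have hself := hF.implicitFunction_apply_self hone hinv
  set φ := hF.implicitFunction hone hinv
  simp only [hTp, hp0] at hiff
  have hsolve : ∀ᶠ q in 𝓝 p, ψ (T (q, φ q)) = 0 := by
    have := hF.eventually_apply_implicitFunction hone hinv
    simpa only [hTp, hp0] using this
  refine ⟨φ, e, hcd, ?_, ?_⟩
  · have hc : Tendsto (fun q : ℝ × E => (q, (0 : ℝ))) (𝓝 p) (𝓝 (p, 0)) :=
      (Continuous.prodMk_left (0 : ℝ)).tendsto p
    filter_upwards [hc.eventually hiff, hUp] with q h1 h2
    rw [hmem q h2, ← h1]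
    simp [T, Prod.mk_zero_zero]
  · have hc : Tendsto (fun w : (ℝ × E) × ℝ => (w.1 + (0, w.2 • e), φ w.1 + w.2))
        (𝓝 (p, 0)) (𝓝 (p, 0)) := by
      have h1 : ContinuousAt φ p := hcd.continuousAt
      have h2 : ContinuousAt (fun w : (ℝ × E) × ℝ => (w.1 + (0, w.2 • e), φ w.1 + w.2))
          (p, 0) := by
        have : ContinuousAt (fun w : (ℝ × E) × ℝ => φ w.1) (p, 0) :=
          ContinuousAt.comp (f := Prod.fst) h1 continuousAt_fst
        fun_prop
      have h3 := h2.tendsto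
      simpa [hself, Prod.mk_zero_zero] using h3
    have hc1 : Tendsto (fun w : (ℝ × E) × ℝ => w.1) (𝓝 (p, 0)) (𝓝 p) := continuousAt_fst
    filter_upwards [hc.eventually hiff, hc1.eventually hsolve] with w h1 h2
    refine h1.1 (Eq.trans ?_ h2)
    congr 1
    simp only [T, add_smul]
    ext
    · simp
    · simp only [Prod.snd_sub, Prod.snd_add]
      abel

namespace IsGraphChartAt

variable {M : Set (ℝ × E)} {φ : ℝ × E → ℝ} {e : E} {p : ℝ × E}

/-- Being a normalised defining function is an open condition along `M`. -/
theorem eventually (h : IsGraphChartAt M φ e p) :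
    ∀ᶠ q in 𝓝 p, q ∈ M → IsGraphChartAt M φ e q := by
  have hc : Tendsto (fun q : ℝ × E => (q, (0 : ℝ))) (𝓝 p) (𝓝 (p, 0)) :=
    (Continuous.prodMk_left (0 : ℝ)).tendsto p
  filter_upwards [h.contDiffAt.eventually (by simp), h.mem_iff.eventually_nhds,
    hc.eventually h.translate.eventually_nhds] with q h1 h2 h3 _
  exact ⟨h1, h2, h3⟩

theorem apply_eq_zero (h : IsGraphChartAt M φ e p) (hp : p ∈ M) : φ p = 0 :=
  h.mem_iff.self_of_nhds.1 hp

theorem hasFDerivAt (h : IsGraphChartAt M φ e p) : HasFDerivAt φ (fderiv ℝ φ p) p :=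
  (h.contDiffAt.differentiableAt (by simp)).hasFDerivAt

theorem fderiv_apply_direction (h : IsGraphChartAt M φ e p) : fderiv ℝ φ p (0, e) = 1 := by
  have hc : Tendsto (fun s : ℝ => (p, s)) (𝓝 0) (𝓝 (p, 0)) :=
    (Continuous.prodMk_right p).tendsto 0
  have h1 : HasDerivAt (fun s : ℝ => φ (p + s • (0, e))) (fderiv ℝ φ p (0, e)) 0 :=
    h.hasFDerivAt.hasLineDerivAt (0, e)
  have h2 : HasDerivAt (fun s : ℝ => φ p + s) 1 0 := (hasDerivAt_id (0 : ℝ)).const_add _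
  refine h1.unique (h2.congr_of_eventuallyEq ?_)
  filter_upwards [hc.eventually h.translate] with s hs
  simpa using hs

/-- The projection onto the zero set of `φ` along the spatial direction `e`. -/
def proj (φ : ℝ × E → ℝ) (e : E) (q : ℝ × E) : ℝ × E := q - (0, φ q • e)

theorem proj_of_mem (h : φ p = 0) : proj φ e p = p := by simp [proj, h]

theorem contDiffAt_proj (h : ContDiffAt ℝ 1 φ p) : ContDiffAt ℝ 1 (proj φ e) p := by
  unfold proj
  fun_prop

theorem tendsto_proj (h : IsGraphChartAt M φ e p) (hp : p ∈ M) :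
    Tendsto (proj φ e) (𝓝 p) (𝓝 p) := by
  have := (contDiffAt_proj (e := e) h.contDiffAt).continuousAt.tendsto
  rwa [proj_of_mem (h.apply_eq_zero hp)] at this

theorem tendsto_neg (h : IsGraphChartAt M φ e p) (hp : p ∈ M) :
    Tendsto (fun q => (q, -φ q)) (𝓝 p) (𝓝 (p, (0 : ℝ))) := by
  have h1 : ContinuousAt φ p := h.contDiffAt.continuousAt
  have h2 : ContinuousAt (fun q => (q, -φ q)) p := by fun_prop
  simpa [h.apply_eq_zero hp] using h2.tendsto

theorem eventually_proj_mem (h : IsGraphChartAt M φ e p) (hp : p ∈ M) :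
    ∀ᶠ q in 𝓝 p, proj φ e q ∈ M := by
  filter_upwards [(h.tendsto_proj hp).eventually h.mem_iff,
    (h.tendsto_neg hp).eventually h.translate] with q h1 h2
  rw [h1]
  have : proj φ e q = q + (0, (-φ q) • e) := by ext <;> simp [proj, sub_eq_add_neg]
  rw [this, h2]; simp

/-- The derivative of `φ` is constant along the direction `e`. -/
theorem eventually_fderiv_proj (h : IsGraphChartAt M φ e p) (hp : p ∈ M) :
    ∀ᶠ q in 𝓝 p, fderiv ℝ φ (proj φ e q) = fderiv ℝ φ q := by
  filter_upwards [(h.tendsto_neg hp).eventually h.translate.eventually_nhds] with q h1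
  have hc : Tendsto (fun q' : ℝ × E => (q', -φ q)) (𝓝 q) (𝓝 (q, -φ q)) :=
    (Continuous.prodMk_left (-φ q)).tendsto q
  have h2 : (fun q' => φ (q' + (0, (-φ q) • e))) =ᶠ[𝓝 q] fun q' => φ q' + -φ q :=
    hc.eventually h1
  have : proj φ e q = q + (0, (-φ q) • e) := by ext <;> simp [proj, sub_eq_add_neg]
  rw [this, ← fderiv_comp_add_right, h2.fderiv_eq, fderiv_add_const]

end IsGraphChartAt
end Charts

/-! ### Jointly continuous spatial derivatives -/

section SpatiallyC1

variable {E F : Type*} [NormedAddCommGroup E] [NormedSpace ℝ E]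
  [NormedAddCommGroup F] [NormedSpace ℝ F]

/-- On a neighbourhood of `p`, the function `f` is continuous and has a derivative with respect to
the space variable that is continuous in space-time. No derivative in time is required. -/
def IsSpatiallyC1At (f : ℝ × E → F) (p : ℝ × E) : Prop :=
  ∃ L : ℝ × E → E →L[ℝ] F, ∀ᶠ q in 𝓝 p, ContinuousAt f q ∧ ContinuousAt L q ∧
    HasFDerivAt (fun y => f (q.1, y)) (L q) q.2

theorem HasFDerivAt.slice {f : ℝ × E → F} {f' : ℝ × E →L[ℝ] F} {q : ℝ × E}
    (h : HasFDerivAt f f' q) :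
    HasFDerivAt (fun y => f (q.1, y)) (f'.comp (ContinuousLinearMap.inr ℝ ℝ E)) q.2 :=
  HasFDerivAt.comp (g := f) q.2 h (hasFDerivAt_prodMk_right q.1 q.2)

theorem ContDiffAt.isSpatiallyC1At {f : ℝ × E → F} {p : ℝ × E} (h : ContDiffAt ℝ 1 f p) :
    IsSpatiallyC1At f p := by
  refine ⟨fun q => (fderiv ℝ f q).comp (ContinuousLinearMap.inr ℝ ℝ E), ?_⟩
  filter_upwards [h.eventually (by simp)] with q hq
  exact ⟨hq.continuousAt, (hq.continuousAt_fderiv (by simp)).clm_comp continuousAt_const,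
    (hq.differentiableAt (by simp)).hasFDerivAt.slice⟩

/-- Symmetry of mixed derivatives: if `φ` is `C¹` and its spatial derivative is `C¹`, then the time
derivative of `φ` is differentiable in space, with derivative `∂ₜ∂ₓφ`. The difference quotients of
`φ` in time converge to `∂ₜφ`, and strict differentiability of `∂ₓφ` makes their spatial derivatives
converge uniformly. -/
theorem isSpatiallyC1At_fderiv_time {φ : ℝ × E → F} {p : ℝ × E} (hφ : ContDiffAt ℝ 1 φ p)
    (hD : ContDiffAt ℝ 1 (fun q => (fderiv ℝ φ q).comp (ContinuousLinearMap.inr ℝ ℝ E)) p) :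
    IsSpatiallyC1At (fun q => fderiv ℝ φ q (1, 0)) p := by
  set D : ℝ × E → E →L[ℝ] F := fun q => (fderiv ℝ φ q).comp (ContinuousLinearMap.inr ℝ ℝ E)
  refine ⟨fun q => fderiv ℝ D q (1, 0), ?_⟩
  filter_upwards [hφ.eventually (by simp), hD.eventually (by simp)] with q hφ hD
  refine ⟨(hφ.continuousAt_fderiv (by simp)).clm_apply continuousAt_const,
    (hD.continuousAt_fderiv (by simp)).clm_apply continuousAt_const, ?_⟩
  have hev : ∀ᶠ q' in 𝓝 q, DifferentiableAt ℝ φ q' :=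
    (hφ.eventually (by simp)).mono fun q' h => h.differentiableAt (by simp)
  have hshift : Tendsto (fun z : ℝ × E => (q.1 + z.1, z.2)) (𝓝 ((0 : ℝ), q.2)) (𝓝 q) := by
    have : Continuous fun z : ℝ × E => (q.1 + z.1, z.2) := by fun_prop
    simpa using this.tendsto ((0 : ℝ), q.2)
  have hbase : Tendsto (fun z : ℝ × E => (q.1, z.2)) (𝓝 ((0 : ℝ), q.2)) (𝓝 q) := by
    have : Continuous fun z : ℝ × E => (q.1, z.2) := by fun_prop
    simpa using this.tendsto ((0 : ℝ), q.2)
  have hle : 𝓝[≠] (0 : ℝ) ×ˢ 𝓝 q.2 ≤ 𝓝 ((0 : ℝ), q.2) := by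
    rw [nhds_prod_eq]; exact Filter.prod_mono nhdsWithin_le_nhds le_rfl
  have hne : ∀ᶠ z : ℝ × E in 𝓝[≠] (0 : ℝ) ×ˢ 𝓝 q.2, z.1 ≠ 0 :=
    tendsto_fst.eventually self_mem_nhdsWithin
  refine hasFDerivAt_of_tendstoUniformlyOnFilter (l := 𝓝[≠] (0 : ℝ))
    (f := fun h y => h⁻¹ • (φ (q.1 + h, y) - φ (q.1, y)))
    (f' := fun h y => h⁻¹ • (D (q.1 + h, y) - D (q.1, y)))
    (g' := fun _ => fderiv ℝ D q (1, 0)) ?_ ?_ ?_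
  · rw [Metric.tendstoUniformlyOnFilter_iff]
    intro ε hε
    have hs : HasStrictFDerivAt D (fderiv ℝ D q) q := hD.hasStrictFDerivAt (by simp)
    have ho := hs.isLittleO.def (half_pos hε)
    have ho' := (hshift.prodMk_nhds hbase).eventually ho
    filter_upwards [hle ho', hne] with z hz hz0
    simp only [Prod.mk_sub_mk, add_sub_cancel_left, sub_self] at hz
    have hz1 : ((z.1, 0) : ℝ × E) = z.1 • (1, 0) := by ext <;> simp
    rw [hz1, map_smul, norm_smul] at hz
    rw [dist_comm, dist_eq_norm]
    have h3 : z.1⁻¹ • (D (q.1 + z.1, z.2) - D (q.1, z.2)) - (fderiv ℝ D q) (1, 0) =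
        z.1⁻¹ • (D (q.1 + z.1, z.2) - D (q.1, z.2) - z.1 • (fderiv ℝ D q) (1, 0)) := by
      rw [smul_sub z.1⁻¹ (_ - _), inv_smul_smul₀ hz0]
    rw [h3, norm_smul, norm_inv]
    have hpos : 0 < ‖z.1‖ := norm_pos_iff.2 hz0
    rw [inv_mul_lt_iff₀ hpos]
    have h4 : ‖((1 : ℝ), (0 : E))‖ = 1 := by simp [Prod.norm_def]
    rw [h4, mul_one] at hz
    nlinarith
  · filter_upwards [hle (hshift.eventually hev), hle (hbase.eventually hev)] with z h1 h2
    exact (h1.hasFDerivAt.slice.sub h2.hasFDerivAt.slice).const_smul z.1⁻¹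
  · have hc : Tendsto (fun y : E => (q.1, y)) (𝓝 q.2) (𝓝 q) :=
      (Continuous.prodMk_right q.1).tendsto q.2
    filter_upwards [hc.eventually hev] with y hy
    have := (hy.hasFDerivAt.hasLineDerivAt ((1 : ℝ), (0 : E))).tendsto_slope_zero
    simpa using this

namespace IsSpatiallyC1At

variable {f : ℝ × E → F} {p : ℝ × E}

theorem continuousAt (h : IsSpatiallyC1At f p) : ContinuousAt f p := by
  obtain ⟨L, hL⟩ := h
  exact hL.self_of_nhds.1

theorem neg (h : IsSpatiallyC1At f p) : IsSpatiallyC1At (fun q => -f q) p := by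
  obtain ⟨L, hL⟩ := h
  exact ⟨fun q => -L q, hL.mono fun q hq => ⟨hq.1.neg, hq.2.1.neg, hq.2.2.neg⟩⟩

theorem smul {c : ℝ × E → ℝ} (hc : IsSpatiallyC1At c p) (hf : IsSpatiallyC1At f p) :
    IsSpatiallyC1At (fun q => c q • f q) p := by
  obtain ⟨L, hL⟩ := hc
  obtain ⟨N, hN⟩ := hf
  refine ⟨fun q => c q • N q + (L q).smulRight (f q), ?_⟩
  filter_upwards [hL, hN] with q h1 h2
  refine ⟨h1.1.smul h2.1, (h1.1.smul h2.2.1).add ?_, h1.2.2.smul h2.2.2⟩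
  have hB := (ContinuousLinearMap.smulRightL ℝ E F).isBoundedBilinearMap.continuous
  exact hB.continuousAt.comp (h1.2.1.prodMk h2.1)

/-- Near `p`, the function is Lipschitz in space with a constant independent of time. -/
theorem exists_lipschitzOnWith (h : IsSpatiallyC1At f p) :
    ∃ K : NNReal, ∃ r > 0, ContinuousOn f (Metric.ball p r) ∧
      ∀ t ∈ Metric.ball p.1 r,
        LipschitzOnWith K (fun y => f (t, y)) (Metric.ball p.2 r) := by
  obtain ⟨L, hL⟩ := h
  have hb : ∀ᶠ q in 𝓝 p, ‖L q‖₊ < ‖L p‖₊ + 1 :=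
    hL.self_of_nhds.2.1.nnnorm.eventually_lt continuousAt_const (by simp)
  obtain ⟨r, hr, hball⟩ := Metric.eventually_nhds_iff_ball.1 (hL.and hb)
  refine ⟨‖L p‖₊ + 1, r, hr, fun q hq => (hball q hq).1.1.continuousWithinAt, fun t ht => ?_⟩
  have hm : ∀ y ∈ Metric.ball p.2 r, (t, y) ∈ Metric.ball p r := fun y hy => by
    rw [← Prod.mk.eta (p := p), ← ball_prod_same]; exact ⟨ht, hy⟩
  exact (convex_ball _ _).lipschitzOnWith_of_nnnorm_hasFDerivWithin_le
    (fun y hy => (hball _ (hm y hy)).1.2.2.hasFDerivWithinAt)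
    (fun y hy => (hball _ (hm y hy)).2.le)

end IsSpatiallyC1At
end SpatiallyC1

/-! ### The constrained initial value problem -/

section ODE

namespace MovingHypersurface

variable {n : ℕ} {J : Set ℝ} {S : ℝ → Set (EuclideanSpace ℝ (Fin n))}
  {w : ℝ × EuclideanSpace ℝ (Fin n) → EuclideanSpace ℝ (Fin n)}

/-- Near each point of the graph, `w` is Lipschitz on the slices with a constant independent of
time. -/
def IsLocallyUniformlyLipschitz (J : Set ℝ) (S : ℝ → Set (EuclideanSpace ℝ (Fin n)))
    (w : ℝ × EuclideanSpace ℝ (Fin n) → EuclideanSpace ℝ (Fin n)) : Prop :=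
  ∀ p ∈ graph J S, ∃ K : NNReal, ∃ r > 0, ∀ t ∈ Metric.ball p.1 r,
    LipschitzOnWith K (fun y => w (t, y)) (S t ∩ Metric.ball p.2 r)

theorem IsLocallyUniformlyLipschitz.locallyLipschitzOn (h : IsLocallyUniformlyLipschitz J S w)
    {t : ℝ} (ht : t ∈ J) : LocallyLipschitzOn (S t) (fun x => w (t, x)) := by
  intro x hx
  obtain ⟨K, r, hr, hK⟩ := h (t, x) ⟨ht, hx⟩
  exact ⟨K, _, inter_mem_nhdsWithin _ (Metric.ball_mem_nhds x hr), hK t (Metric.mem_ball_self hr)⟩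

theorem IsACSolution.continuousOn {I : Set ℝ} {t₀ : ℝ} {x₀ : EuclideanSpace ℝ (Fin n)}
    {x : ℝ → EuclideanSpace ℝ (Fin n)} (h : IsACSolution S w I t₀ x₀ x) {a b : ℝ} (hab : a ≤ b)
    (ha : a ∈ I) (hb : b ∈ I) : ContinuousOn x (Icc a b) := by
  simpa [uIcc_of_le hab] using (h.absCont a ha b hb).continuousOn

/-- A solution of the integral equation for a continuous field is differentiable, one-sidedly at the
ends of the interval. -/
theorem IsACSolution.hasDerivWithinAt (hw : ContinuousOn w (graph J S)) {I : Set ℝ}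
    (hI : I.OrdConnected) (hIJ : I ⊆ J) {t₀ : ℝ} {x₀ : EuclideanSpace ℝ (Fin n)}
    {x : ℝ → EuclideanSpace ℝ (Fin n)} (h : IsACSolution S w I t₀ x₀ x) {a b : ℝ} (ha : a ∈ I)
    (hb : b ∈ I) {t : ℝ} (ht : t ∈ Icc a b) :
    HasDerivWithinAt x (w (t, x t)) (Icc a b) t := by
  have hab : a ≤ b := ht.1.trans ht.2
  have hsub : Icc a b ⊆ I := hI.out ha hb
  have hcont : ContinuousOn (fun s => w (s, x s)) (Icc a b) :=
    hw.comp (continuousOn_id.prodMk (h.continuousOn hab ha hb))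
      fun s hs => ⟨hIJ (hsub hs), h.mem_slice s (hsub hs)⟩
  -- Extending the integrand constantly beyond `[a, b]` makes it continuous on `ℝ`.
  let g : ℝ → EuclideanSpace ℝ (Fin n) := IccExtend hab ((Icc a b).domRestrict fun s => w (s, x s))
  have hg : Continuous g := hcont.domRestrict.Icc_extend'
  have hgw : ∀ s ∈ Icc a b, g s = w (s, x s) := fun s hs => by
    simp [g, IccExtend_of_mem hab _ hs]
  have hx : ∀ s ∈ Icc a b, x s = x a + ∫ τ in a..s, g τ := fun s hs => by
    have h1 := h.eq_integral s (hsub hs)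
    have h2 := h.eq_integral a ha
    have h3 := intervalIntegral.integral_interval_sub_left (h.integrable s (hsub hs))
      (h.integrable a ha)
    have h4 : ∫ τ in a..s, g τ = ∫ τ in a..s, w (τ, x τ) := by
      refine intervalIntegral.integral_congr fun τ hτ => ?_
      rw [uIcc_of_le hs.1] at hτ
      exact hgw τ ⟨hτ.1, hτ.2.trans hs.2⟩
    rw [h4, ← h3, h1]
    nth_rw 1 [h2]
    abel
  have hd : HasDerivAt (fun s => x a + ∫ τ in a..s, g τ) (g t) t :=
    (hg.integral_hasStrictDerivAt a t).hasDerivAt.const_add _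
  rw [← hgw t ht]
  exact hd.hasDerivWithinAt.congr hx (hx t ht)

/-- The set where two constrained solutions agree is closed, and it is relatively open by Grönwall's
inequality, applied forward and backward in time. -/
theorem eqOn_Icc_of_isLocallyUniformlyLipschitz (hL : IsLocallyUniformlyLipschitz J S w)
    {a b : ℝ} (hJ : Icc a b ⊆ J) {x y : ℝ → EuclideanSpace ℝ (Fin n)}
    (hx : ∀ t ∈ Icc a b, HasDerivWithinAt x (w (t, x t)) (Icc a b) t)
    (hxS : ∀ t ∈ Icc a b, x t ∈ S t)
    (hy : ∀ t ∈ Icc a b, HasDerivWithinAt y (w (t, y t)) (Icc a b) t)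
    (hyS : ∀ t ∈ Icc a b, y t ∈ S t) {t₀ : ℝ} (ht₀ : t₀ ∈ Icc a b) (h₀ : x t₀ = y t₀) :
    EqOn x y (Icc a b) := by
  have hxc : ContinuousOn x (Icc a b) := fun t ht => (hx t ht).continuousWithinAt
  have hyc : ContinuousOn y (Icc a b) := fun t ht => (hy t ht).continuousWithinAt
  have hloc : ∀ t₁ ∈ Icc a b, x t₁ = y t₁ → ∀ᶠ s in 𝓝[Icc a b] t₁, x s = y s := by
    intro t₁ ht₁ h₁
    obtain ⟨K, r, hr, hK⟩ := hL (t₁, x t₁) ⟨hJ ht₁, hxS t₁ ht₁⟩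
    have hbx : ∀ᶠ s in 𝓝[Icc a b] t₁, x s ∈ Metric.ball (x t₁) r :=
      (hxc t₁ ht₁).eventually (Metric.ball_mem_nhds _ hr)
    have hby : ∀ᶠ s in 𝓝[Icc a b] t₁, y s ∈ Metric.ball (x t₁) r :=
      (hyc t₁ ht₁).eventually (by rw [h₁]; exact Metric.ball_mem_nhds _ hr)
    obtain ⟨δ, hδ, hball⟩ := Metric.eventually_nhds_iff_ball.1
      (eventually_nhdsWithin_iff.1 (hbx.and hby))
    have hmem : ∀ s ∈ Icc a b, dist s t₁ < min δ r → ∀ t ∈ uIcc t₁ s, t ∈ Icc a b ∧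
        t ∈ Metric.ball t₁ r ∧ x t ∈ S t ∩ Metric.ball (x t₁) r ∧
        y t ∈ S t ∩ Metric.ball (x t₁) r := by
      intro s hs hsd t ht
      have h1 : t ∈ Icc a b := ordConnected_Icc.uIcc_subset ht₁ hs ht
      have h2 : dist t t₁ ≤ dist s t₁ := by
        rw [dist_comm t, dist_comm s]; exact Real.dist_left_le_of_mem_uIcc ht
      have h3 := hball t (h2.trans_lt (hsd.trans_le (min_le_left _ _))) h1
      exact ⟨h1, h2.trans_lt (hsd.trans_le (min_le_right _ _)), ⟨hxS t h1, h3.1⟩, hyS t h1, h3.2⟩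
    have hδr : ∀ᶠ s in 𝓝[Icc a b] t₁, dist s t₁ < min δ r :=
      mem_nhdsWithin_of_mem_nhds (Metric.ball_mem_nhds t₁ (lt_min hδ hr))
    filter_upwards [self_mem_nhdsWithin, hδr] with s hs hsd
    have hm := hmem s hs hsd
    rcases le_total t₁ s with hts | hts
    · rw [uIcc_of_le hts] at hm
      have hIcc : ∀ t ∈ Ico t₁ s, Icc a b ∈ 𝓝[≥] t := fun t ht =>
        Icc_mem_nhdsGE_of_mem ⟨ht₁.1.trans ht.1, ht.2.trans_le hs.2⟩
      have hsub : Icc t₁ s ⊆ Icc a b := Icc_subset_Icc ht₁.1 hs.2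
      refine ODE_solution_unique_of_mem_Icc_right (v := fun t z => w (t, z))
        (s := fun t => S t ∩ Metric.ball (x t₁) r) (K := K)
        (fun t ht => hK t (hm t (Ico_subset_Icc_self ht)).2.1) (hxc.mono hsub)
        (fun t ht => (hx t (hsub (Ico_subset_Icc_self ht))).mono_of_mem_nhdsWithin (hIcc t ht))
        (fun t ht => (hm t (Ico_subset_Icc_self ht)).2.2.1) (hyc.mono hsub)
        (fun t ht => (hy t (hsub (Ico_subset_Icc_self ht))).mono_of_mem_nhdsWithin (hIcc t ht))
        (fun t ht => (hm t (Ico_subset_Icc_self ht)).2.2.2) h₁ ⟨hts, le_rfl⟩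
    · rw [uIcc_of_ge hts] at hm
      have hIcc : ∀ t ∈ Ioc s t₁, Icc a b ∈ 𝓝[≤] t := fun t ht =>
        Icc_mem_nhdsLE_of_mem ⟨hs.1.trans_lt ht.1, ht.2.trans ht₁.2⟩
      have hsub : Icc s t₁ ⊆ Icc a b := Icc_subset_Icc hs.1 ht₁.2
      refine ODE_solution_unique_of_mem_Icc_left (v := fun t z => w (t, z))
        (s := fun t => S t ∩ Metric.ball (x t₁) r) (K := K)
        (fun t ht => hK t (hm t (Ioc_subset_Icc_self ht)).2.1) (hxc.mono hsub)
        (fun t ht => (hx t (hsub (Ioc_subset_Icc_self ht))).mono_of_mem_nhdsWithin (hIcc t ht))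
        (fun t ht => (hm t (Ioc_subset_Icc_self ht)).2.2.1) (hyc.mono hsub)
        (fun t ht => (hy t (hsub (Ioc_subset_Icc_self ht))).mono_of_mem_nhdsWithin (hIcc t ht))
        (fun t ht => (hm t (Ioc_subset_Icc_self ht)).2.2.2) h₁ ⟨le_rfl, hts⟩
  have hconn : PreconnectedSpace (Icc a b) := Subtype.preconnectedSpace isPreconnected_Icc
  have hclopen : IsClopen {t : Icc a b | x t = y t} := by
    refine ⟨isClosed_eq hxc.domRestrict hyc.domRestrict, isOpen_iff_mem_nhds.2 fun t ht => ?_⟩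
    exact (eventually_nhds_subtype_iff (Icc a b) t fun s => x s = y s).2 (hloc t t.2 ht)
  have huniv := hclopen.eq_univ ⟨⟨t₀, ht₀⟩, h₀⟩
  intro t ht
  exact (Set.ext_iff.1 huniv ⟨t, ht⟩).2 trivial

theorem IsACSolution.eqOn (hw : ContinuousOn w (graph J S))
    (hL : IsLocallyUniformlyLipschitz J S w) {I : Set ℝ}
    (hI : I.OrdConnected) (hIJ : I ⊆ J) {t₀ : ℝ} (ht₀ : t₀ ∈ I) {x₀ : EuclideanSpace ℝ (Fin n)}
    {x y : ℝ → EuclideanSpace ℝ (Fin n)} (hx : IsACSolution S w I t₀ x₀ x)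
    (hy : IsACSolution S w I t₀ x₀ y) : EqOn x y I := by
  intro s hs
  have ha : min t₀ s ∈ I := by rcases min_choice t₀ s with h | h <;> rwa [h]
  have hb : max t₀ s ∈ I := by rcases max_choice t₀ s with h | h <;> rwa [h]
  have hsub : Icc (min t₀ s) (max t₀ s) ⊆ I := hI.out ha hb
  refine eqOn_Icc_of_isLocallyUniformlyLipschitz hL (hsub.trans hIJ)
    (fun t ht => hx.hasDerivWithinAt hw hI hIJ ha hb ht) (fun t ht => hx.mem_slice t (hsub ht))
    (fun t ht => hy.hasDerivWithinAt hw hI hIJ ha hb ht) (fun t ht => hy.mem_slice t (hsub ht))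
    (left_mem_uIcc : t₀ ∈ uIcc t₀ s) ?_ (right_mem_uIcc : s ∈ uIcc t₀ s)
  rw [hx.eq_integral t₀ ht₀, hy.eq_integral t₀ ht₀]
  simp

/-- If `w` extends near `p` to a spatially `C¹` field `W` along which the defining function `φ` is
stationary, then the initial value problem has a solution that stays on the graph. -/
theorem exists_isACSolution {W : ℝ × EuclideanSpace ℝ (Fin n) → EuclideanSpace ℝ (Fin n)}
    {φ : ℝ × EuclideanSpace ℝ (Fin n) → ℝ} {p : ℝ × EuclideanSpace ℝ (Fin n)}
    (hp : p ∈ graph J S) (hW : IsSpatiallyC1At W p)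
    (hmem : ∀ᶠ q in 𝓝 p, (q ∈ graph J S ↔ φ q = 0))
    (hφ : ∀ᶠ q in 𝓝 p, DifferentiableAt ℝ φ q) (hflow : ∀ᶠ q in 𝓝 p, fderiv ℝ φ q (1, W q) = 0)
    (heq : ∀ᶠ q in 𝓝 p, q ∈ graph J S → w q = W q) :
    ∃ ε > 0, Icc (p.1 - ε) (p.1 + ε) ⊆ J ∧
      ∃ x, IsACSolution S w (Icc (p.1 - ε) (p.1 + ε)) p.1 p.2 x := by
  obtain ⟨K, r₁, hr₁, hWc, hWK⟩ := hW.exists_lipschitzOnWith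
  have hb : ∀ᶠ q in 𝓝 p, ‖W q‖₊ < ‖W p‖₊ + 1 :=
    hW.continuousAt.nnnorm.eventually_lt continuousAt_const (by simp)
  obtain ⟨r₂, hr₂, hball⟩ := Metric.eventually_nhds_iff_ball.1
    (hmem.and (hφ.and (hflow.and (heq.and hb))))
  obtain ⟨r, hr, hrr₁, hrr₂⟩ : ∃ r > 0, r ≤ r₁ ∧ r ≤ r₂ :=
    ⟨min r₁ r₂, lt_min hr₁ hr₂, min_le_left _ _, min_le_right _ _⟩
  have hprod : ∀ {t : ℝ} {z : EuclideanSpace ℝ (Fin n)} {ρ : ℝ}, t ∈ Metric.ball p.1 ρ →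
      z ∈ Metric.ball p.2 ρ → (t, z) ∈ Metric.ball p ρ := fun ht hz => by
    rw [← Prod.mk.eta (p := p), ← ball_prod_same]; exact ⟨ht, hz⟩
  set L : NNReal := ‖W p‖₊ + 1 with hLdef
  have hL : 0 < L := by positivity
  obtain ⟨a, ha⟩ : ∃ a : NNReal, (a : ℝ) = r / 2 := ⟨⟨r / 2, by positivity⟩, rfl⟩
  have ha0 : (0 : ℝ) < a := by rw [ha]; positivity
  have har : (a : ℝ) < r := by rw [ha]; linarith
  obtain ⟨ε, hε, hεa, hεL⟩ : ∃ ε > 0, ε ≤ (a : ℝ) ∧ L * ε ≤ a := by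
    refine ⟨min a (a / L), lt_min ha0 (by positivity), min_le_left _ _, ?_⟩
    calc (L : ℝ) * min a (a / L) ≤ L * (a / L) := by gcongr; exact min_le_right _ _
      _ = a := by field_simp
  have htime : ∀ t ∈ Icc (p.1 - ε) (p.1 + ε), t ∈ Metric.ball p.1 r := fun t ht => by
    rw [Metric.mem_ball, Real.dist_eq]
    exact (abs_le.2 ⟨by linarith [ht.1], by linarith [ht.2]⟩ : |t - p.1| ≤ ε).trans_lt
      (hεa.trans_lt har)
  have hspace : Metric.closedBall p.2 a ⊆ Metric.ball p.2 r := Metric.closedBall_subset_ball har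
  have hPL : IsPicardLindelof (fun t z => W (t, z)) (tmin := p.1 - ε) (tmax := p.1 + ε)
      ⟨p.1, by constructor <;> linarith⟩ p.2 a 0 L K := by
    refine ⟨fun t ht => ?_, fun z hz => ?_, fun t ht z hz => ?_, ?_⟩
    · exact (hWK t (Metric.ball_subset_ball hrr₁ (htime t ht))).mono
        (hspace.trans (Metric.ball_subset_ball hrr₁))
    · exact hWc.comp (by fun_prop) fun t ht =>
        Metric.ball_subset_ball hrr₁ (hprod (htime t ht) (hspace hz))
    · exact_mod_cast (hball _ (Metric.ball_subset_ball hrr₂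
        (hprod (htime t ht) (hspace hz)))).2.2.2.2.le
    · simpa using hεL
  obtain ⟨x, hx0, hx⟩ := hPL.exists_eq_forall_mem_Icc_hasDerivWithinAt₀
  simp only at hx0
  have hxc : ContinuousAt x p.1 :=
    (hx p.1 (by constructor <;> linarith)).continuousWithinAt.continuousAt
      (Icc_mem_nhds (by linarith) (by linarith))
  -- Shorten the time interval so that the solution stays where all local properties hold.
  obtain ⟨δ₁, hδ₁, hxball⟩ := Metric.continuousAt_iff.1 hxc r hr
  obtain ⟨δ, hδ, hδε, hδδ₁⟩ : ∃ δ > 0, δ ≤ ε ∧ δ < δ₁ :=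
    ⟨min ε (δ₁ / 2), lt_min hε (by positivity), min_le_left _ _,
      (min_le_right _ _).trans_lt (by linarith)⟩
  set I := Icc (p.1 - δ) (p.1 + δ) with hI
  have h0I : p.1 ∈ I := by constructor <;> linarith
  have hIsub : I ⊆ Icc (p.1 - ε) (p.1 + ε) := Icc_subset_Icc (by linarith) (by linarith)
  have hin : ∀ t ∈ I, (t, x t) ∈ Metric.ball p r := fun t ht => by
    refine hprod (htime t (hIsub ht)) ?_
    rw [← hx0]
    refine hxball (lt_of_le_of_lt ?_ hδδ₁)
    rw [Real.dist_eq]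
    exact abs_le.2 ⟨by linarith [ht.1], by linarith [ht.2]⟩
  have hin₂ : ∀ t ∈ I, (t, x t) ∈ Metric.ball p r₂ := fun t ht =>
    Metric.ball_subset_ball hrr₂ (hin t ht)
  have hxI : ∀ t ∈ I, HasDerivWithinAt x (W (t, x t)) I t := fun t ht =>
    (hx t (hIsub ht)).mono hIsub
  -- `φ` is constant along the solution, which therefore stays on the graph.
  have hφ0 : ∀ t ∈ I, φ (t, x t) = 0 := by
    have hd : ∀ t ∈ I, HasDerivWithinAt (fun s => φ (s, x s)) 0 I t := fun t ht => by
      have h1 : HasDerivWithinAt (fun s => φ (s, x s)) (fderiv ℝ φ (t, x t) (1, W (t, x t))) I t :=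
        (hball _ (hin₂ t ht)).2.1.hasFDerivAt.comp_hasDerivWithinAt t
          ((hasDerivWithinAt_id t I).prodMk (hxI t ht))
      rwa [(hball _ (hin₂ t ht)).2.2.1] at h1
    intro t ht
    have h3 := (convex_Icc _ _).norm_image_sub_le_of_norm_hasDerivWithin_le (C := 0) hd
      (by simp) h0I ht
    have h4 : φ (p.1, x p.1) = 0 := by
      rw [hx0]; exact (hmem.self_of_nhds).1 hp
    rw [h4] at h3
    simpa using h3
  have hxM : ∀ t ∈ I, (t, x t) ∈ graph J S := fun t ht =>
    (hball _ (hin₂ t ht)).1.2 (hφ0 t ht)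
  have hwW : ∀ t ∈ I, w (t, x t) = W (t, x t) := fun t ht =>
    (hball _ (hin₂ t ht)).2.2.2.1 (hxM t ht)
  have hxcI : ContinuousOn x I := fun t ht => (hxI t ht).continuousWithinAt
  have hwc : ContinuousOn (fun s => w (s, x s)) I := by
    refine ContinuousOn.congr ?_ hwW
    exact hWc.comp (continuousOn_id.prodMk hxcI) fun t ht =>
      Metric.ball_subset_ball hrr₁ (hin t ht)
  have huI : ∀ c ∈ I, ∀ d ∈ I, uIcc c d ⊆ I := fun c hc d hd => ordConnected_Icc.uIcc_subset hc hd
  have hint : ∀ t ∈ I, IntervalIntegrable (fun s => w (s, x s)) volume p.1 t := fun t ht =>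
    (hwc.mono (huI _ h0I _ ht)).intervalIntegrable
  refine ⟨δ, hδ, fun t ht => (hxM t ht).1, x, ?_, fun t ht => (hxM t ht).2, hint, fun t ht => ?_⟩
  · intro c hc d hd
    have hlip : LipschitzOnWith L x I :=
      (convex_Icc _ _).lipschitzOnWith_of_nnnorm_hasDerivWithin_le hxI
        fun t ht => (hball _ (hin₂ t ht)).2.2.2.2.le
    exact (hlip.mono (huI c hc d hd)).absolutelyContinuousOnInterval
  · have hsub := huI _ h0I _ ht
    rw [intervalIntegral.integral_eq_sub_of_hasDeriv_right (hxcI.mono hsub) ?_ (hint t ht), hx0]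
    · abel
    · intro s hs
      have hsI : s ∈ I := hsub (Ioo_subset_Icc_self hs)
      rw [hwW s hsI]
      have hn : uIcc p.1 t ∈ 𝓝 s := Icc_mem_nhds hs.1 hs.2
      exact ((hxI s hsI).hasDerivAt (mem_of_superset hn hsub)).hasDerivWithinAt

end MovingHypersurface
end ODE

/-! ### Normal vectors and normal speed -/

section Geometry

namespace MovingHypersurface

variable {n : ℕ} {J : Set ℝ} {S : ℝ → Set (EuclideanSpace ℝ (Fin n))}
  {ν : ℝ × EuclideanSpace ℝ (Fin n) → EuclideanSpace ℝ (Fin n)}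
  {φ : ℝ × EuclideanSpace ℝ (Fin n) → ℝ} {e : EuclideanSpace ℝ (Fin n)}
  {p : ℝ × EuclideanSpace ℝ (Fin n)}

/-- The kernel of the spatial derivative of `φ` is tangent to the slice: the curve
`s ↦ x + s v - φ (t, x + s v) e` runs in the slice and has velocity `v`. -/
theorem mem_tangentConeAt_of_fderiv_eq_zero (h : IsGraphChartAt (graph J S) φ e p)
    (hp : p ∈ graph J S) {v : EuclideanSpace ℝ (Fin n)} (hv : fderiv ℝ φ p (0, v) = 0) :
    v ∈ tangentConeAt ℝ (S p.1) p.2 := by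
  have hφp := h.apply_eq_zero hp
  have hslope : Tendsto (fun s : ℝ => s⁻¹ * φ (p + s • (0, v))) (𝓝[≠] 0) (𝓝 0) := by
    have := (h.hasFDerivAt.hasLineDerivAt (0, v)).tendsto_slope_zero
    simpa only [hv, hφp, sub_zero, smul_eq_mul] using this
  have hline : Tendsto (fun s : ℝ => p + s • ((0 : ℝ), v)) (𝓝[≠] 0) (𝓝 p) := by
    have : Continuous fun s : ℝ => p + s • ((0 : ℝ), v) := by fun_prop
    have := (this.tendsto 0).mono_left (nhdsWithin_le_nhds (s := {0}ᶜ))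
    simpa only [zero_smul, add_zero] using this
  have hφ0 : Tendsto (fun s : ℝ => φ (p + s • (0, v))) (𝓝[≠] 0) (𝓝 0) := by
    have := h.contDiffAt.continuousAt.tendsto.comp hline
    rwa [hφp] at this
  have hid : Tendsto (fun s : ℝ => s) (𝓝[≠] 0) (𝓝 0) := nhdsWithin_le_nhds
  refine mem_tangentConeAt_of_seq (𝓝[≠] (0 : ℝ)) (fun s => s⁻¹)
    (fun s => s • v - φ (p + s • (0, v)) • e) ?_ ?_ ?_
  · simpa only [zero_smul, sub_zero] using
      (hid.smul_const v).sub (hφ0.smul_const e)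
  · filter_upwards [hline.eventually (h.eventually_proj_mem hp)] with s hs
    have := hs.2
    simpa [IsGraphChartAt.proj, add_sub_assoc] using this
  · have h1 : Tendsto (fun s : ℝ => v - (s⁻¹ * φ (p + s • (0, v))) • e) (𝓝[≠] 0) (𝓝 v) := by
      simpa only [zero_smul, sub_zero] using (hslope.smul_const e).const_sub v
    refine h1.congr' ?_
    filter_upwards [self_mem_nhdsWithin] with s hs
    rw [smul_sub, inv_smul_smul₀ hs, smul_smul]

/-- The spatial derivative of `φ` is `⟨ν, ·⟩ / ⟨ν, e⟩`. -/
theorem inner_normal_eq (h : IsGraphChartAt (graph J S) φ e p) (hp : p ∈ graph J S)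
    (hν : IsUnitNormalField (S p.1) fun x => ν (p.1, x)) (v : EuclideanSpace ℝ (Fin n)) :
    inner ℝ (ν p) v = fderiv ℝ φ p (0, v) * inner ℝ (ν p) e := by
  have h1 : fderiv ℝ φ p (0, v - fderiv ℝ φ p (0, v) • e) = 0 := by
    have : ((0 : ℝ), v - fderiv ℝ φ p (0, v) • e) = (0, v) - fderiv ℝ φ p (0, v) • (0, e) := by
      ext <;> simp
    rw [this, map_sub, map_smul, h.fderiv_apply_direction]
    simp
  have h2 := (hν.2 p.2 hp.2).2 _ (mem_tangentConeAt_of_fderiv_eq_zero h hp h1)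
  rw [inner_sub_right, inner_smul_right] at h2
  exact sub_eq_zero.1 h2

theorem fderiv_normal_mul_inner (h : IsGraphChartAt (graph J S) φ e p) (hp : p ∈ graph J S)
    (hν : IsUnitNormalField (S p.1) fun x => ν (p.1, x)) :
    fderiv ℝ φ p (0, ν p) * inner ℝ (ν p) e = 1 := by
  rw [← inner_normal_eq h hp hν, real_inner_self_eq_norm_sq]
  have := (hν.2 p.2 hp.2).1
  simp only [Prod.mk.eta] at this
  rw [this, one_pow]

theorem inner_normal_ne_zero (h : IsGraphChartAt (graph J S) φ e p) (hp : p ∈ graph J S)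
    (hν : IsUnitNormalField (S p.1) fun x => ν (p.1, x)) : inner ℝ (ν p) e ≠ 0 :=
  right_ne_zero_of_mul_eq_one (fderiv_normal_mul_inner h hp hν)

/-- A normal speed is characterised by the vanishing of the derivative of `φ` in the direction
`(1, c ν)`, since `|φ|` is comparable to the distance from the slice. -/
theorem isNormalSpeedAt_iff (h : IsGraphChartAt (graph J S) φ e p) (hp : p ∈ graph J S) (c : ℝ) :
    IsNormalSpeedAt S ν p c ↔ fderiv ℝ φ p (1, c • ν p) = 0 := by
  set z : ℝ × EuclideanSpace ℝ (Fin n) := (1, c • ν p) with hz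
  have hφp := h.apply_eq_zero hp
  have hline : Tendsto (fun s : ℝ => p + s • z) (𝓝[>] 0) (𝓝 p) := by
    have : Continuous fun s : ℝ => p + s • z := by fun_prop
    have := (this.tendsto 0).mono_left (nhdsWithin_le_nhds (s := Ioi 0))
    simpa only [zero_smul, add_zero] using this
  have hslope : Tendsto (fun s : ℝ => s⁻¹ * φ (p + s • z)) (𝓝[>] 0) (𝓝 (fderiv ℝ φ p z)) := by
    have := (h.hasFDerivAt.hasLineDerivAt z).tendsto_slope_zero.mono_left
      (nhdsWithin_mono (0 : ℝ) (show Ioi (0 : ℝ) ⊆ {0}ᶜ from fun s hs => ne_of_gt hs))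
    simpa only [hφp, sub_zero, smul_eq_mul] using this
  have hφ0 : Tendsto (fun s : ℝ => φ (p + s • z)) (𝓝[>] 0) (𝓝 0) := by
    have := h.contDiffAt.continuousAt.tendsto.comp hline
    rwa [hφp] at this
  set d : ℝ → ℝ := fun s => Metric.infDist (p.2 + (s * c) • ν p) (S (p.1 + s)) with hd
  have hpt : ∀ s : ℝ, p + s • z = (p.1 + s, p.2 + (s * c) • ν p) := fun s => by
    ext <;> simp [hz, mul_assoc]
  have hproj : ∀ᶠ s in 𝓝[>] (0 : ℝ),
      p.2 + (s * c) • ν p - φ (p + s • z) • e ∈ S (p.1 + s) := by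
    filter_upwards [hline.eventually (h.eventually_proj_mem hp)] with s hs
    have := hs.2
    simp only [IsGraphChartAt.proj, Prod.fst_sub, Prod.snd_sub, sub_zero] at this
    rw [hpt] at this ⊢
    exact this
  have hup : ∀ᶠ s in 𝓝[>] (0 : ℝ), d s ≤ |φ (p + s • z)| * ‖e‖ := by
    filter_upwards [hproj] with s hs
    refine (Metric.infDist_le_dist_of_mem hs).trans (le_of_eq ?_)
    rw [dist_eq_norm, sub_sub_cancel, norm_smul, Real.norm_eq_abs]
  have hd0 : Tendsto d (𝓝[>] 0) (𝓝 0) := by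
    refine squeeze_zero' (Eventually.of_forall fun s => Metric.infDist_nonneg) hup ?_
    simpa using hφ0.abs.mul_const ‖e‖
  obtain ⟨K, t, ht, hK⟩ := h.contDiffAt.exists_lipschitzOnWith
  obtain ⟨r, hr, hball⟩ := Metric.eventually_nhds_iff_ball.1 (h.mem_iff.and ht)
  -- `φ` is Lipschitz and vanishes on the slice. Only slice points near `p` are controlled, but they
  -- realise the infimum because the distance tends to zero.
  have hlow : ∀ᶠ s in 𝓝[>] (0 : ℝ), |φ (p + s • z)| ≤ K * d s := by
    filter_upwards [hproj, hd0.eventually (gt_mem_nhds (half_pos hr)),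
      hline.eventually (Metric.ball_mem_nhds p (half_pos hr)),
      hline.eventually (h.eventually_proj_mem hp)] with s hs hds hps hgr
    have hsJ : p.1 + s ∈ J := by
      have := hgr.1
      rw [hpt] at this
      simpa [IsGraphChartAt.proj] using this
    have hlim : Tendsto (fun ρ : ℝ => K * ρ) (𝓝[>] d s) (𝓝 (K * d s)) :=
      (tendsto_id.mono_left nhdsWithin_le_nhds).const_mul _
    refine ge_of_tendsto hlim ?_
    filter_upwards [self_mem_nhdsWithin, mem_nhdsWithin_of_mem_nhds (gt_mem_nhds hds)]
      with ρ hρ hρr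
    obtain ⟨y, hy, hyd⟩ := (Metric.infDist_lt_iff ⟨_, hs⟩).1 hρ
    have hdist : dist (p + s • z) (p.1 + s, y) < ρ := by
      rw [hpt, Prod.dist_eq]
      simpa using hyd
    have hyb : (p.1 + s, y) ∈ Metric.ball p r := by
      rw [Metric.mem_ball]
      calc dist (p.1 + s, y) p ≤ dist (p.1 + s, y) (p + s • z) + dist (p + s • z) p :=
            dist_triangle _ _ _
        _ < r / 2 + r / 2 := by
            rw [dist_comm _ (p + s • z)]
            exact add_lt_add (hdist.trans hρr) hps
        _ = r := add_halves r
    have hy0 : φ (p.1 + s, y) = 0 := (hball _ hyb).1.1 ⟨hsJ, hy⟩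
    have hpb : p + s • z ∈ Metric.ball p r := Metric.ball_subset_ball (half_le_self hr.le) hps
    have := hK.dist_le_mul _ (hball _ hpb).2 _ (hball _ hyb).2
    rw [hy0, Real.dist_eq, sub_zero] at this
    exact this.trans (by gcongr)
  have hpos : ∀ᶠ s in 𝓝[>] (0 : ℝ), 0 < s := self_mem_nhdsWithin
  constructor
  · intro hc
    have h0 : Tendsto (fun s : ℝ => s⁻¹ * φ (p + s • z)) (𝓝[>] 0) (𝓝 0) := by
      refine squeeze_zero_norm' (a := fun s => K * (s⁻¹ * d s)) ?_
        (by simpa using hc.const_mul (K : ℝ))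
      filter_upwards [hlow, hpos] with s hs hs0
      rw [norm_mul, Real.norm_eq_abs, Real.norm_eq_abs, abs_of_pos (inv_pos.2 hs0)]
      calc s⁻¹ * |φ (p + s • z)| ≤ s⁻¹ * (K * d s) := by gcongr
        _ = K * (s⁻¹ * d s) := by ring
    exact tendsto_nhds_unique hslope h0
  · intro h0
    rw [h0] at hslope
    refine squeeze_zero' (g := fun s => |s⁻¹ * φ (p + s • z)| * ‖e‖) ?_ ?_
      (by simpa using hslope.abs.mul_const ‖e‖)
    · filter_upwards [hpos] with s hs
      exact mul_nonneg (inv_pos.2 hs).le Metric.infDist_nonneg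
    · filter_upwards [hup, hpos] with s hs hs0
      rw [abs_mul, abs_of_pos (inv_pos.2 hs0), mul_assoc]
      gcongr

theorem isNormalSpeedAt_iff_eq (h : IsGraphChartAt (graph J S) φ e p) (hp : p ∈ graph J S)
    (hν : IsUnitNormalField (S p.1) fun x => ν (p.1, x)) (c : ℝ) :
    IsNormalSpeedAt S ν p c ↔ c = -(fderiv ℝ φ p (1, 0) * inner ℝ (ν p) e) := by
  have h1 := fderiv_normal_mul_inner h hp hν
  have h2 : ((1 : ℝ), c • ν p) = (1, 0) + c • (0, ν p) := by ext <;> simp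
  rw [isNormalSpeedAt_iff h hp, h2, map_add, map_smul, smul_eq_mul]
  constructor
  · intro h3
    linear_combination (inner ℝ (ν p) e) * h3 - c * h1
  · rintro rfl
    linear_combination -(fderiv ℝ φ p (1, 0)) * h1

/-! ### Surface derivatives -/

/-- The map `v ↦ v - ⟨u, v⟩ u`, for a unit vector `u` the orthogonal projection onto the hyperplane
`u^⊥`. -/
noncomputable def tangentialProj (u : EuclideanSpace ℝ (Fin n)) :
    EuclideanSpace ℝ (Fin n) →L[ℝ] EuclideanSpace ℝ (Fin n) :=
  ContinuousLinearMap.id ℝ _ - (innerSL ℝ u).smulRight u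

theorem tangentialProj_apply (u v : EuclideanSpace ℝ (Fin n)) :
    tangentialProj u v = v - inner ℝ u v • u := by
  simp [tangentialProj]

theorem continuous_tangentialProj :
    Continuous (tangentialProj : EuclideanSpace ℝ (Fin n) → _) := by
  have hB := (ContinuousLinearMap.smulRightL ℝ (EuclideanSpace ℝ (Fin n))
    (EuclideanSpace ℝ (Fin n))).isBoundedBilinearMap.continuous
  exact continuous_const.sub (hB.comp ((innerSL ℝ).continuous.prodMk continuous_id))

variable {F : Type*} [NormedAddCommGroup F] [NormedSpace ℝ F]

/-- A derivative along the slice may be made to vanish on the normal: `φ` vanishes on the slice, so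
multiples of its derivative can be subtracted. -/
theorem hasFDerivWithinAt_comp_tangentialProj (h : IsGraphChartAt (graph J S) φ e p)
    (hp : p ∈ graph J S) (hν : IsUnitNormalField (S p.1) fun x => ν (p.1, x))
    {f : EuclideanSpace ℝ (Fin n) → F} {L : EuclideanSpace ℝ (Fin n) →L[ℝ] F}
    (hf : HasFDerivWithinAt f L (S p.1) p.2) :
    HasFDerivWithinAt f (L.comp (tangentialProj (ν p))) (S p.1) p.2 := by
  set D := (fderiv ℝ φ p).comp (ContinuousLinearMap.inr ℝ ℝ (EuclideanSpace ℝ (Fin n)))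
  have hslice : ∀ᶠ y in 𝓝[S p.1] p.2, φ (p.1, y) = 0 := by
    have hc : Tendsto (fun y => (p.1, y)) (𝓝[S p.1] p.2) (𝓝 p) :=
      ((Continuous.prodMk_right p.1).tendsto p.2).mono_left nhdsWithin_le_nhds
    filter_upwards [hc.eventually h.mem_iff, self_mem_nhdsWithin] with y h1 h2
    exact h1.1 ⟨hp.1, h2⟩
  have h0 : HasFDerivWithinAt (fun _ => (0 : ℝ)) D (S p.1) p.2 :=
    h.hasFDerivAt.slice.hasFDerivWithinAt.congr_of_eventuallyEq
      (hslice.mono fun y hy => hy.symm) (h.apply_eq_zero hp).symm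
  have h1 := hf.sub (h0.smul_const (inner ℝ (ν p) e • L (ν p)))
  have hL : L - D.smulRight (inner ℝ (ν p) e • L (ν p)) = L.comp (tangentialProj (ν p)) := by
    ext v
    have h2 := inner_normal_eq h hp hν v
    simp [D, tangentialProj_apply, h2, smul_smul]
  rw [hL] at h1
  exact h1.congr (fun y _ => by simp) (by simp)

/-- Derivatives along the slice are determined on the tangent space. -/
theorem comp_tangentialProj_unique (h : IsGraphChartAt (graph J S) φ e p)
    (hp : p ∈ graph J S) (hν : IsUnitNormalField (S p.1) fun x => ν (p.1, x))
    {f : EuclideanSpace ℝ (Fin n) → F} {L L' : EuclideanSpace ℝ (Fin n) →L[ℝ] F}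
    (hL : HasFDerivWithinAt f L (S p.1) p.2) (hL' : HasFDerivWithinAt f L' (S p.1) p.2) :
    L.comp (tangentialProj (ν p)) = L'.comp (tangentialProj (ν p)) := by
  ext v
  refine hL.unique_on hL' (mem_tangentConeAt_of_fderiv_eq_zero h hp ?_)
  have h1 := inner_normal_eq h hp hν (tangentialProj (ν p) v)
  have h2 : inner ℝ (ν p) (tangentialProj (ν p) v) = 0 := by
    have h3 := (hν.2 p.2 hp.2).1
    simp only [Prod.mk.eta] at h3
    rw [tangentialProj_apply, inner_sub_right, inner_smul_right, real_inner_self_eq_norm_sq, h3]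
    ring
  rw [h2] at h1
  exact (mul_eq_zero.1 h1.symm).resolve_right (inner_normal_ne_zero h hp hν)

theorem IsC12Family.exists_isGraphChartAt (hS : IsC12Family J S ν)
    (hT : IsTransversalToSlices J S) (hp : p ∈ graph J S) :
    ∃ φ e, IsGraphChartAt (graph J S) φ e p := by
  obtain ⟨z, hz, hz1⟩ := hT p hp
  exact _root_.exists_isGraphChartAt hS.hypersurface_graph hp hz hz1

theorem IsC12Family.continuousOn_normal (hS : IsC12Family J S ν) :
    ContinuousOn ν (graph J S) := by
  intro p hp
  obtain ⟨U, hU, hpU, g, hg, hgν⟩ := hS.normal_graph p hp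
  have h1 : ContinuousWithinAt g (graph J S) p :=
    (hg.continuousOn.continuousAt (hU.mem_nhds hpU)).continuousWithinAt
  refine h1.congr_of_eventuallyEq ?_ (hgν p ⟨hp, hpU⟩).symm
  filter_upwards [self_mem_nhdsWithin, mem_nhdsWithin_of_mem_nhds (hU.mem_nhds hpU)] with q h2 h3
  exact (hgν q ⟨h2, h3⟩).symm

/-- Near each point of `M`, the function `f` is the restriction of a function with a jointly
continuous spatial derivative. -/
def HasSpatialC1Extension (M : Set (ℝ × EuclideanSpace ℝ (Fin n)))
    (f : ℝ × EuclideanSpace ℝ (Fin n) → F) : Prop :=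
  ∀ p ∈ M, ∃ g, IsSpatiallyC1At g p ∧ ∀ᶠ q in 𝓝 p, q ∈ M → f q = g q

theorem HasSpatialC1Extension.continuousOn {M : Set (ℝ × EuclideanSpace ℝ (Fin n))}
    {f : ℝ × EuclideanSpace ℝ (Fin n) → F} (hf : HasSpatialC1Extension M f) :
    ContinuousOn f M := by
  intro p hp
  obtain ⟨g, hg, hfg⟩ := hf p hp
  exact hg.continuousAt.continuousWithinAt.congr_of_eventuallyEq
    (eventually_nhdsWithin_iff.2 hfg) (hfg.self_of_nhds hp)

theorem HasSpatialC1Extension.isLocallyUniformlyLipschitz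
    {f : ℝ × EuclideanSpace ℝ (Fin n) → EuclideanSpace ℝ (Fin n)} (hJ : IsOpen J)
    (hf : HasSpatialC1Extension (graph J S) f) : IsLocallyUniformlyLipschitz J S f := by
  intro p hp
  obtain ⟨g, hg, hfg⟩ := hf p hp
  obtain ⟨K, r₁, hr₁, -, hK⟩ := hg.exists_lipschitzOnWith
  have hJ' : ∀ᶠ q : ℝ × EuclideanSpace ℝ (Fin n) in 𝓝 p, q.1 ∈ J :=
    continuousAt_fst.eventually (hJ.mem_nhds hp.1)
  obtain ⟨r₂, hr₂, hball⟩ := Metric.eventually_nhds_iff_ball.1 (hfg.and hJ')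
  refine ⟨K, min r₁ r₂, lt_min hr₁ hr₂, fun t ht => ?_⟩
  have h1 := (hK t (Metric.ball_subset_ball (min_le_left _ _) ht)).mono
    (inter_subset_right.trans (Metric.ball_subset_ball (min_le_left r₁ r₂)) :
      S t ∩ Metric.ball p.2 (min r₁ r₂) ⊆ _)
  have h2 : ∀ y ∈ S t ∩ Metric.ball p.2 (min r₁ r₂), f (t, y) = g (t, y) := fun y hy => by
    have h3 : (t, y) ∈ Metric.ball p r₂ := by
      rw [← Prod.mk.eta (p := p), ← ball_prod_same]
      exact ⟨Metric.ball_subset_ball (min_le_right _ _) ht,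
        Metric.ball_subset_ball (min_le_right _ _) hy.2⟩
    exact (hball _ h3).1 ⟨(hball _ h3).2, hy.1⟩
  intro y hy y' hy'
  simp only [h2 y hy, h2 y' hy']
  exact h1 hy hy'

/-- The surface derivative exists and is continuous on the graph. It is defined from an arbitrary
derivative along the slice; uniqueness on tangent vectors identifies it locally with the one
obtained from a spatially `C¹` extension. -/
theorem exists_surfaceDerivative (hS : IsC12Family J S ν) (hT : IsTransversalToSlices J S)
    {f : ℝ × EuclideanSpace ℝ (Fin n) → F} (hf : HasSpatialC1Extension (graph J S) f) :
    ∃ A : ℝ × EuclideanSpace ℝ (Fin n) → EuclideanSpace ℝ (Fin n) →L[ℝ] F,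
      (∀ p ∈ graph J S,
        HasFDerivWithinAt (fun y => f (p.1, y)) (A p) (S p.1) p.2 ∧ A p (ν p) = 0) ∧
      ContinuousOn A (graph J S) := by
  have hloc : ∀ p ∈ graph J S, ∃ L : ℝ × EuclideanSpace ℝ (Fin n) →
      EuclideanSpace ℝ (Fin n) →L[ℝ] F, ContinuousAt L p ∧
      ∀ᶠ q in 𝓝 p, q ∈ graph J S →
        HasFDerivWithinAt (fun y => f (q.1, y)) (L q) (S q.1) q.2 := by
    intro p hp
    obtain ⟨g, ⟨L, hL⟩, hfg⟩ := hf p hp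
    refine ⟨L, hL.self_of_nhds.2.1, ?_⟩
    filter_upwards [hL, hfg.eventually_nhds] with q h1 h2 hq
    have hc : Tendsto (fun y => (q.1, y)) (𝓝[S q.1] q.2) (𝓝 q) :=
      ((Continuous.prodMk_right q.1).tendsto q.2).mono_left nhdsWithin_le_nhds
    refine h1.2.2.hasFDerivWithinAt.congr_of_eventuallyEq ?_ (h2.self_of_nhds hq)
    filter_upwards [hc.eventually h2, self_mem_nhdsWithin] with y h3 h4
    exact h3 ⟨hq.1, h4⟩
  let D : ℝ × EuclideanSpace ℝ (Fin n) → EuclideanSpace ℝ (Fin n) →L[ℝ] F :=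
    fun p => fderivWithin ℝ (fun y => f (p.1, y)) (S p.1) p.2
  have hD : ∀ p ∈ graph J S, HasFDerivWithinAt (fun y => f (p.1, y)) (D p) (S p.1) p.2 :=
    fun p hp => by
      obtain ⟨L, -, hL⟩ := hloc p hp
      exact (hL.self_of_nhds hp).differentiableWithinAt.hasFDerivWithinAt
  refine ⟨fun p => (D p).comp (tangentialProj (ν p)), fun p hp => ?_, fun p hp => ?_⟩
  · obtain ⟨φ, e, h⟩ := hS.exists_isGraphChartAt hT hp
    refine ⟨hasFDerivWithinAt_comp_tangentialProj h hp (hS.normal_slice _ hp.1) (hD p hp), ?_⟩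
    have h3 := ((hS.normal_slice _ hp.1).2 p.2 hp.2).1
    simp only [Prod.mk.eta] at h3
    simp [tangentialProj_apply, h3]
  · obtain ⟨L, hLc, hL⟩ := hloc p hp
    have hc : ContinuousWithinAt (fun q => (L q).comp (tangentialProj (ν q))) (graph J S) p :=
      hLc.continuousWithinAt.clm_comp
        (continuous_tangentialProj.continuousAt.comp_continuousWithinAt
          (hS.continuousOn_normal p hp))
    have heq : ∀ q ∈ graph J S, HasFDerivWithinAt (fun y => f (q.1, y)) (L q) (S q.1) q.2 →
        (D q).comp (tangentialProj (ν q)) = (L q).comp (tangentialProj (ν q)) := fun q hq h1 => by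
      obtain ⟨φ, e, h⟩ := hS.exists_isGraphChartAt hT hq
      exact comp_tangentialProj_unique h hq (hS.normal_slice _ hq.1) (hD q hq) h1
    refine hc.congr_of_eventuallyEq ?_ (heq p hp (hL.self_of_nhds hp))
    filter_upwards [self_mem_nhdsWithin, mem_nhdsWithin_of_mem_nhds hL] with q h1 h2
    exact heq q h1 (h2 h1)

/-! ### The velocity field -/

/-- The normal speed and the normal velocity have local extensions `v` and `W` with jointly
continuous spatial derivatives, and the defining function `φ` is stationary along `W` off the graph
as well. With `N` the normal at the projected point, they are `v = -∂ₜφ ⟨N, e⟩` and `W = v N`. -/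
theorem exists_velocity_extension (hS : IsC12Family J S ν) (hp : p ∈ graph J S)
    (h : IsGraphChartAt (graph J S) φ e p) :
    ∃ (W : ℝ × EuclideanSpace ℝ (Fin n) → EuclideanSpace ℝ (Fin n))
      (v : ℝ × EuclideanSpace ℝ (Fin n) → ℝ), IsSpatiallyC1At W p ∧ IsSpatiallyC1At v p ∧
      (∀ᶠ q in 𝓝 p, fderiv ℝ φ q (1, W q) = 0) ∧
      ∀ᶠ q in 𝓝 p, q ∈ graph J S → ∀ c, IsNormalSpeedAt S ν q c → v q = c ∧ W q = c • ν q := by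
  obtain ⟨U, hU, hpU, g, hg, hgν⟩ := hS.normal_graph p hp
  have hUp : U ∈ 𝓝 p := hU.mem_nhds hpU
  let X := IsGraphChartAt.proj φ e
  have hX : ContDiffAt ℝ 1 X p := IsGraphChartAt.contDiffAt_proj h.contDiffAt
  have hXp : X p = p := IsGraphChartAt.proj_of_mem (h.apply_eq_zero hp)
  have hXt : Tendsto X (𝓝 p) (𝓝 p) := h.tendsto_proj hp
  let N := fun q => g (X q)
  have hN : ContDiffAt ℝ 1 N p :=
    ContDiffAt.comp p (by rw [hXp]; exact hg.contDiffAt hUp) hX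
  have hNe : ContDiffAt ℝ 1 (fun q => inner ℝ (N q) e) p := hN.inner ℝ contDiffAt_const
  have hchart := (h.eventually_proj_mem hp).and
    ((hXt.eventually h.eventually).and (hXt.eventually hUp))
  have hev : ∀ᶠ q in 𝓝 p, (∀ v, inner ℝ (N q) v = fderiv ℝ φ q (0, v) * inner ℝ (N q) e) ∧
      fderiv ℝ φ q (0, N q) * inner ℝ (N q) e = 1 := by
    filter_upwards [hchart, h.eventually_fderiv_proj hp] with q hq hq'
    have hNq : N q = ν (X q) := hgν _ ⟨hq.1, hq.2.2⟩
    rw [hNq, ← hq']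
    exact ⟨inner_normal_eq (hq.2.1 hq.1) hq.1 (hS.normal_slice _ hq.1.1),
      fderiv_normal_mul_inner (hq.2.1 hq.1) hq.1 (hS.normal_slice _ hq.1.1)⟩
  -- The spatial derivative of `φ` is `⟨N, ·⟩ / ⟨N, e⟩`, hence as smooth as the normal.
  have hD : ContDiffAt ℝ 1 (fun q => (fderiv ℝ φ q).comp
      (ContinuousLinearMap.inr ℝ ℝ (EuclideanSpace ℝ (Fin n)))) p := by
    -- `innerSL` is typed as conjugate-linear; this is the same map, typed as linear.
    let B : EuclideanSpace ℝ (Fin n) →L[ℝ] EuclideanSpace ℝ (Fin n) →L[ℝ] ℝ :=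
      (isBoundedBilinearMap_inner (𝕜 := ℝ) (E := EuclideanSpace ℝ (Fin n))).toContinuousLinearMap
    have h1 : ContDiffAt ℝ 1 (fun q => (inner ℝ (N q) e)⁻¹ • B (N q)) p :=
      (hNe.inv (right_ne_zero_of_mul_eq_one hev.self_of_nhds.2)).smul
        (B.contDiff.contDiffAt.comp p hN)
    refine h1.congr_of_eventuallyEq ?_
    filter_upwards [hev] with q hq
    ext v
    have h2 : B (N q) v = inner ℝ (N q) v := rfl
    have h3 := right_ne_zero_of_mul_eq_one hq.2
    simp [h2, hq.1 v]
    field_simp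
  have hγ := (isSpatiallyC1At_fderiv_time h.contDiffAt hD).neg
  have hv := hγ.smul hNe.isSpatiallyC1At
  refine ⟨_, _, hv.smul hN.isSpatiallyC1At, hv, ?_, ?_⟩
  · filter_upwards [hev] with q hq
    set a := -(fderiv ℝ φ q) (1, 0) with ha
    have h1 : ((1 : ℝ), (a • inner ℝ (N q) e) • N q) =
        (1, 0) + (a * inner ℝ (N q) e) • (0, N q) := by ext <;> simp
    rw [h1, map_add, map_smul, smul_eq_mul]
    linear_combination a * hq.2 - ha
  · filter_upwards [h.eventually, hUp] with q hq hqU hqM c hc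
    have hXq : X q = q := IsGraphChartAt.proj_of_mem ((hq hqM).apply_eq_zero hqM)
    have hNq : N q = ν q := by
      simp only [N, hXq]; exact hgν _ ⟨hqM, hqU⟩
    rw [isNormalSpeedAt_iff_eq (hq hqM) hqM (hS.normal_slice _ hqM.1)] at hc
    rw [hNq, hc]
    simp

end MovingHypersurface
end Geometry

theorem mainTheorem4 {n : ℕ} (J : Set ℝ) (hJo : IsOpen J) (hJc : J.OrdConnected)
    (S : ℝ → Set (EuclideanSpace ℝ (Fin n)))
    (ν : ℝ × EuclideanSpace ℝ (Fin n) → EuclideanSpace ℝ (Fin n))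
    (hS : MovingHypersurface.IsC12Family J S ν)
    (hT : MovingHypersurface.IsTransversalToSlices J S) :
    (∀ p ∈ MovingHypersurface.graph J S, ∃! c : ℝ, MovingHypersurface.IsNormalSpeedAt S ν p c) ∧
    ∀ V : ℝ × EuclideanSpace ℝ (Fin n) → ℝ,
      (∀ p ∈ MovingHypersurface.graph J S, MovingHypersurface.IsNormalSpeedAt S ν p (V p)) →
      ContinuousOn V (MovingHypersurface.graph J S) ∧
      (∃ G, MovingHypersurface.IsSurfaceGradient J S ν V G ∧
        ContinuousOn G (MovingHypersurface.graph J S)) ∧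
      ContinuousOn (fun p => V p • ν p) (MovingHypersurface.graph J S) ∧
      (∃ A, MovingHypersurface.IsSurfaceJacobian J S ν (fun p => V p • ν p) A ∧
        ContinuousOn A (MovingHypersurface.graph J S)) ∧
      MovingHypersurface.IsConsistent J S (fun p => V p • ν p) := by
  open MovingHypersurface in
  refine ⟨fun p hp => ?_, fun V hV => ?_⟩
  · obtain ⟨φ, e, h⟩ := hS.exists_isGraphChartAt hT hp
    simp only [isNormalSpeedAt_iff_eq h hp (hS.normal_slice _ hp.1)]
    exact existsUnique_eq
  have hVext : HasSpatialC1Extension (graph J S) V := fun p hp => by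
    obtain ⟨φ, e, h⟩ := hS.exists_isGraphChartAt hT hp
    obtain ⟨W, v, -, hv, -, hev⟩ := exists_velocity_extension hS hp h
    exact ⟨v, hv, hev.mono fun q hq hqM => (hq hqM _ (hV q hqM)).1.symm⟩
  have hwext : HasSpatialC1Extension (graph J S) fun p => V p • ν p := fun p hp => by
    obtain ⟨φ, e, h⟩ := hS.exists_isGraphChartAt hT hp
    obtain ⟨W, v, hW, -, -, hev⟩ := exists_velocity_extension hS hp h
    exact ⟨W, hW, hev.mono fun q hq hqM => (hq hqM _ (hV q hqM)).2.symm⟩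
  have hL := hwext.isLocallyUniformlyLipschitz hJo
  refine ⟨hVext.continuousOn, ?_, hwext.continuousOn, exists_surfaceDerivative hS hT hwext,
    hwext.continuousOn, fun t ht => hL.locallyLipschitzOn ht, fun t₀ ht₀ x₀ hx₀ => ?_,
    fun t₀ ht₀ x₀ hx₀ I hI ht₀I hIJ x y hx hy => hx.eqOn hwext.continuousOn hL hI hIJ ht₀I hy⟩
  · obtain ⟨A, hA, hAc⟩ := exists_surfaceDerivative hS hT hVext
    refine ⟨fun p => (InnerProductSpace.toDual ℝ _).symm (A p), fun p hp => ⟨?_, ?_⟩,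
      (InnerProductSpace.toDual ℝ _).symm.continuous.comp_continuousOn hAc⟩
    · rw [hasGradientWithinAt_iff_hasFDerivWithinAt, LinearIsometryEquiv.apply_symm_apply]
      exact (hA p hp).1
    · rw [InnerProductSpace.toDual_symm_apply]
      exact (hA p hp).2
  · obtain ⟨φ, e, h⟩ := hS.exists_isGraphChartAt hT (p := (t₀, x₀)) ⟨ht₀, hx₀⟩
    obtain ⟨W, v, hW, -, hflow, hev⟩ := exists_velocity_extension hS ⟨ht₀, hx₀⟩ h
    exact exists_isACSolution ⟨ht₀, hx₀⟩ hW h.mem_iff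
      ((h.contDiffAt.eventually (by simp)).mono fun q hq => hq.differentiableAt (by simp)) hflow
      (hev.mono fun q hq hqM => (hq hqM _ (hV q hqM)).2.symm)
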